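/- Let $M\ge 2$ be an integer, let $d,\lambda,\rho>0$, and let $x\in[-1,1]$. For $v\in\mathbb R$ let $\mathbf a(v)=\big[1,\ e^{j\frac{2\pi d}{\lambda}v},\dots,e^{j\frac{2\pi d}{\lambda}(M-1)v}\big]^{\mathrm H}\in\mathbb C^M$ (a column vector), and let $[u]_{-1}^{1}=\max\{\min\{u,1\},-1\}$. Let $z_1,z_2,\dots$ be i.i.d. circularly symmetric complex Gaussian random variables with mean $0$ and variance $1$, and let $\hat x_0$ be a real random variable that is independent of $(z_n)_{n\ge1}$. Let $\alpha>0$, $N_0\ge 0$ be real numbers and $a_n=\alpha/(n+N_0)$. For $n\ge1$ define recursively $$\mathbf w_n=\frac{\mathbf a(\hat x_{n-1})}{\sqrt M},\qquad y_n=\mathbf w_n^{\mathrm H}\mathbf a(x)+\frac{z_n}{\sqrt\rho},\qquad \hat x_n=\big[\hat x_{n-1}-a_n\operatorname{Im}\{y_n\}\big]_{-1}^{1}.$$ Let $$f(v,x)=-\frac1{\sqrt M}\operatorname{Im}\{\mathbf a(v)^{\mathrm H}\mathbf a(x)\}=-\frac1{\sqrt M}\sum_{m=1}^{M}\sin\Big(\frac{2\pi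 d(m-1)(v-x)}{\lambda}\Big)$$ and $\mathcal S(x)=\{v\in(-1,1]: f(v,x)=0,\ \partial_v f(v,x)<0\}$. Then $$\mathcal S(x)=\Big\{v\in(-1,1]: v=x+\frac{k\lambda}{(M-1)d}\text{ for some }k\in\mathbb Z\Big\},$$ and, with probability one, $\hat x_n$ converges as $n\to\infty$ to a single (possibly random) point of $\mathcal S(x)\cup\{-1\}\cup\{1\}$. -/

import Mathlib

open MeasureTheory ProbabilityTheory Filter Topology Matrix
open scoped NNReal

namespace BeamTracking

noncomputable section

/-- The circularly symmetric complex Gaussian distribution `CN(u, s)` with mean `u` and variance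
`s`: the real and imaginary parts are independent, each of variance `s / 2`. -/
def complexGaussian (u : ℂ) (s : ℝ≥0) : Measure ℂ :=
  ((gaussianReal 0 (s / 2)).prod (gaussianReal 0 (s / 2))).map
    fun p : ℝ × ℝ => u + ((p.1 : ℂ) + (p.2 : ℂ) * Complex.I)

/-- The steering vector `a(v)` of a linear array of `M` antennas with spacing `d` at wavelength
`lam`: the Hermitian transpose of the row `(1, e^{j 2πdv/lam}, …, e^{j 2πd(M-1)v/lam})`.
The index `m : Fin M` runs from `0` to `M - 1`. -/
def steeringVector (M : ℕ) (d lam v : ℝ) : Fin M → ℂ :=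
  star fun m : Fin M => Complex.exp (Complex.I * ((2 * Real.pi * d / lam * (m : ℕ) * v : ℝ) : ℂ))

/-- The analog beamforming vector `a(v) / √M` pointing in the direction `v`. -/
def beamformer (M : ℕ) (d lam v : ℝ) : Fin M → ℂ :=
  ((1 / √(M : ℝ) : ℝ) : ℂ) • steeringVector M d lam v

/-- The observation `w^H a(x) + z / √ρ` obtained with the beamforming vector `w`, when the beam
direction is `x`, the SNR is `ρ` and the noise is `z`. -/
def observation (M : ℕ) (d lam ρ x : ℝ) (w : Fin M → ℂ) (z : ℂ) : ℂ :=
  star w ⬝ᵥ steeringVector M d lam x + z / ((√ρ : ℝ) : ℂ)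

/-- The projection `[v]_{-1}^{1}` onto the feasible region `[-1, 1]`. -/
def proj (v : ℝ) : ℝ := max (min v 1) (-1)

/-- The diminishing step size `a_n = α / (n + N₀)`. -/
def stepSize (α N₀ : ℝ) (n : ℕ) : ℝ := α / ((n : ℝ) + N₀)

/-- The sequence of estimates of the recursive beam tracker with step sizes `a`, for the static
beam direction `x`, started at `x₀` and driven by the noise values `z 1, z 2, …`
(the value `z 0` is not used): in time slot `n ≥ 1` the beamformer points in the direction of the
estimate number `n - 1`, and `x̂_n = [x̂_{n-1} - a_n Im y_n]_{-1}^{1}`. -/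
def estimate (M : ℕ) (d lam ρ x : ℝ) (a : ℕ → ℝ) (x₀ : ℝ) (z : ℕ → ℂ) : ℕ → ℝ
  | 0 => x₀
  | n + 1 =>
    proj (estimate M d lam ρ x a x₀ z n - a (n + 1) *
      (observation M d lam ρ x
        (beamformer M d lam (estimate M d lam ρ x a x₀ z n)) (z (n + 1))).im)

/-- The mean field `f(v, x) = -(1/√M) Im (a(v)^H a(x))`. -/
def meanField (M : ℕ) (d lam v x : ℝ) : ℝ :=
  -(1 / √(M : ℝ)) * (star (steeringVector M d lam v) ⬝ᵥ steeringVector M d lam x).im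

/-- The mean field as an explicit sum of sines. -/
theorem meanField_eq_sum (M : ℕ) (d lam v x : ℝ) :
    meanField M d lam v x =
      -(1 / √(M : ℝ)) * ∑ m : Fin M, Real.sin (2 * Real.pi * d * (m : ℕ) * (v - x) / lam) := by
  unfold meanField steeringVector
  congr 1
  simp only [star_star, dotProduct, Complex.im_sum]
  refine Finset.sum_congr rfl fun m _ => ?_
  rw [Pi.star_apply, Complex.star_def, ← Complex.exp_conj, ← Complex.exp_add]
  have h : Complex.I * ((2 * Real.pi * d / lam * (m : ℕ) * v : ℝ) : ℂ) +
      (starRingEnd ℂ) (Complex.I * ((2 * Real.pi * d / lam * (m : ℕ) * x : ℝ) : ℂ)) =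
      ((2 * Real.pi * d * (m : ℕ) * (v - x) / lam : ℝ) : ℂ) * Complex.I := by
    rw [map_mul, Complex.conj_I, Complex.conj_ofReal]
    push_cast
    ring
  rw [h, Complex.exp_ofReal_mul_I_im]

/-- The set `S(x)` of stable points: the points of `(-1, 1]` at which the mean field
vanishes and has a negative derivative in its first argument. -/
def stablePoints (M : ℕ) (d lam x : ℝ) : Set ℝ :=
  {v | v ∈ Set.Ioc (-1 : ℝ) 1 ∧ meanField M d lam v x = 0 ∧
    deriv (fun u => meanField M d lam u x) v < 0}

end

end BeamTracking

/-!
The tracker runs a Robbins–Monro recursion `v (n + 1) = v n + a n (f (v n) + w n)`, projected to an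
interval. Almost surely the noise series `∑ a n w n` converges, by `L²`-bounded martingale
convergence, and the convergence of the path is then deterministic. If the path crossed an interval
infinitely often it would also cross, against the drift, a small neighbourhood of a point `c` of
that interval with `f c ≠ 0`; the noise alone would have to carry it through, which the Cauchy
property of the noise series forbids. At an interior limit `f` vanishes because `∑ a n = ∞`.

An interior zero `u` where `f` has positive derivative is not a limit: near `u` the function `f` is
increasing, so two paths that differ only in one noise value drift apart and cannot both converge to
`u`. Given the other noise values, convergence to `u` thus pins that one to a single point, which
has probability zero as the noise has no atoms.

For the beam tracker, `(∑ sin (2 m t)) sin t = sin ((M - 1) t) sin (M t)` factors the mean field: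
its derivative is negative at the zeros of the first factor and positive at the remaining zeros of
the second.
-/

namespace StochasticApproximation

section Clamp

variable {lo hi : ℝ}

/-- The nearest-point projection of the real line onto the interval `[lo, hi]`. -/
def clamp (lo hi v : ℝ) : ℝ := max lo (min hi v)

theorem clamp_mem_Icc (h : lo ≤ hi) (v : ℝ) : clamp lo hi v ∈ Set.Icc lo hi :=
  ⟨le_max_left _ _, max_le h (min_le_left _ _)⟩

theorem min_le_clamp (lo hi v : ℝ) : min hi v ≤ clamp lo hi v := le_max_right _ _

theorem clamp_eq_self_of_mem_Ioo {v : ℝ} (hv : clamp lo hi v ∈ Set.Ioo lo hi) :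
    clamp lo hi v = v := by
  unfold clamp at hv ⊢
  grind

theorem clamp_neg_neg_neg (h : lo ≤ hi) (v : ℝ) : clamp (-hi) (-lo) (-v) = -clamp lo hi v := by
  unfold clamp
  grind

theorem continuous_clamp (lo hi : ℝ) : Continuous (clamp lo hi) := by
  unfold clamp
  fun_prop

end Clamp

/-- `v` solves the recursion `v (n + 1) = clamp (v n + a n * (f (v n) + w n))` of projected
stochastic approximation on `[lo, hi]`, with mean field `f`, step sizes `a` and noise `w`. -/
def IsProjRec (lo hi : ℝ) (f : ℝ → ℝ) (a w v : ℕ → ℝ) : Prop :=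
  ∀ n, v (n + 1) = clamp lo hi (v n + a n * (f (v n) + w n))

/-- The solution of the recursion `IsProjRec` with initial value `x₀`. -/
def projRec (lo hi : ℝ) (f : ℝ → ℝ) (a : ℕ → ℝ) (x₀ : ℝ) (w : ℕ → ℝ) : ℕ → ℝ
  | 0 => x₀
  | n + 1 => clamp lo hi (projRec lo hi f a x₀ w n + a n * (f (projRec lo hi f a x₀ w n) + w n))

theorem isProjRec_projRec (lo hi : ℝ) (f : ℝ → ℝ) (a : ℕ → ℝ) (x₀ : ℝ) (w : ℕ → ℝ) :
    IsProjRec lo hi f a w (projRec lo hi f a x₀ w) := fun _ => rfl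

theorem summable_sub_of_monotone_of_tendsto {T : ℕ → ℝ} {l : ℝ} (hT : Monotone T)
    (hl : Tendsto T atTop (𝓝 l)) : Summable fun n => T (n + 1) - T n := by
  refine ⟨l - T 0, ?_⟩
  rw [hasSum_iff_tendsto_nat_of_nonneg fun n => sub_nonneg.2 (hT n.le_succ)]
  simpa only [Finset.sum_range_sub] using hl.sub_const (T 0)

theorem exists_Ioo_monotoneOn_of_deriv_pos {f : ℝ → ℝ} (hf : ContDiff ℝ 1 f) {u : ℝ}
    (hu : 0 < deriv f u) : ∃ ε > 0, MonotoneOn f (Set.Ioo (u - ε) (u + ε)) := by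
  obtain ⟨ε, hε, hpos⟩ := Metric.eventually_nhds_iff_ball.1
    ((hf.continuous_deriv le_rfl).continuousAt.eventually_const_lt hu)
  refine ⟨ε, hε, ?_⟩
  rw [← Real.ball_eq_Ioo]
  exact monotoneOn_of_deriv_nonneg (convex_ball u ε) hf.continuous.continuousOn
    (hf.differentiable one_ne_zero).differentiableOn
    fun v hv => (hpos v (interior_subset hv)).le

namespace IsProjRec

variable {lo hi : ℝ} {f : ℝ → ℝ} {a w v : ℕ → ℝ}

theorem eventually_mem_Icc (h : IsProjRec lo hi f a w v) (hlh : lo ≤ hi) :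
    ∀ᶠ n in atTop, v n ∈ Set.Icc lo hi :=
  (eventually_gt_atTop 0).mono fun n hn => by
    rw [← Nat.sub_add_cancel hn, h]
    exact clamp_mem_Icc hlh _

theorem eq_of_mem_Ioo (h : IsProjRec lo hi f a w v) {n : ℕ} (hn : v (n + 1) ∈ Set.Ioo lo hi) :
    v (n + 1) = v n + a n * (f (v n) + w n) := by
  rw [h n] at hn ⊢
  exact clamp_eq_self_of_mem_Ioo hn

theorem neg (h : IsProjRec lo hi f a w v) (hlh : lo ≤ hi) :
    IsProjRec (-hi) (-lo) (fun u => -f (-u)) a (-w) (-v) := fun n => by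
  simp only [Pi.neg_apply, neg_neg, h n]
  rw [← clamp_neg_neg_neg hlh]
  congr 1
  ring

theorem cauchySeq_sum_mul_neg (hw : CauchySeq fun n => ∑ i ∈ Finset.range n, a i * w i) :
    CauchySeq fun n => ∑ i ∈ Finset.range n, a i * (-w) i := by
  simp only [Pi.neg_apply, mul_neg, Finset.sum_neg_distrib]
  exact hw.neg

theorem tendsto_increment (h : IsProjRec lo hi f a w v) (hlh : lo ≤ hi) (hf : Continuous f)
    (ha : Tendsto a atTop (𝓝 0))
    (hw : CauchySeq fun n => ∑ i ∈ Finset.range n, a i * w i) :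
    Tendsto (fun n => a n * (f (v n) + w n)) atTop (𝓝 0) := by
  obtain ⟨l, hl⟩ := cauchySeq_tendsto_of_complete hw
  have hnoise : Tendsto (fun n => a n * w n) atTop (𝓝 0) := by
    simpa [Finset.sum_range_succ] using ((tendsto_add_atTop_iff_nat 1).2 hl).sub hl
  obtain ⟨C, hC⟩ := isCompact_Icc.exists_bound_of_continuousOn (s := Set.Icc lo hi) hf.continuousOn
  have hdrift : Tendsto (fun n => a n * f (v n)) atTop (𝓝 0) :=
    ha.zero_mul_isBoundedUnder_le <| isBoundedUnder_of_eventually_le (a := C) <|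
      (h.eventually_mem_Icc hlh).mono fun n hn => hC _ hn
  simpa [mul_add] using hdrift.add hnoise

-- Between two visits to `[c, ∞)` the drift is nonnegative, so the path falls below its last entry
-- point by at most the oscillation of the partial sums of the noise.
theorem eventually_sub_lt_of_frequently_lt (h : IsProjRec lo hi f a w v) (hlh : lo ≤ hi)
    (hf : Continuous f) (ha0 : ∀ n, 0 ≤ a n) (ha : Tendsto a atTop (𝓝 0))
    (hw : CauchySeq fun n => ∑ i ∈ Finset.range n, a i * w i)
    {c δ : ℝ} (hc : c ≤ hi) (hδ : 0 < δ) (hfc : ∀ u ∈ Set.Ioo (c - δ) c, 0 ≤ f u)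
    (hfreq : ∃ᶠ n in atTop, c < v n) : ∀ᶠ n in atTop, c - δ < v n := by
  set S : ℕ → ℝ := fun n => ∑ i ∈ Finset.range n, a i * w i
  obtain ⟨N, hN⟩ := eventually_atTop.1 <| (h.tendsto_increment hlh hf ha hw).eventually_const_lt
    (show -(δ / 2) < 0 by linarith)
  obtain ⟨N', hN'⟩ := Metric.cauchySeq_iff.1 hw (δ / 2) (by linarith)
  have hosc {m n : ℕ} (hm : N' ≤ m) (hn : N' ≤ n) : S m - S n < δ / 2 :=
    (le_abs_self _).trans_lt (hN' n hn m hm |>.trans_eq' (by rw [dist_comm, Real.dist_eq]))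
  obtain ⟨n₀, hn₀, hcn₀⟩ := frequently_atTop.1 hfreq (max N N')
  have hexcursion : ∀ n ≥ n₀, ∃ s ≥ N', c - δ / 2 ≤ v n - (S n - S s) := by
    intro n hn
    induction n, hn using Nat.le_induction with
    | base => exact ⟨n₀, by omega, by linarith⟩
    | succ n hn ih =>
      have hstep : min hi (v n + a n * (f (v n) + w n)) ≤ v (n + 1) :=
        h n ▸ min_le_clamp _ _ _
      rcases le_or_gt (c - δ / 2) (v (n + 1)) with hge | hlt
      · exact ⟨n + 1, by omega, by linarith⟩
      obtain ⟨s, hs, hvs⟩ := ih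
      have hincr := hN n (by omega)
      have hvc : v n < c := by grind
      have hdrift : 0 ≤ a n * f (v n) :=
        mul_nonneg (ha0 n) (hfc _ ⟨by linarith [hosc hs (show N' ≤ n by omega)], hvc⟩)
      have hS : S (n + 1) = S n + a n * w n := Finset.sum_range_succ _ _
      refine ⟨s, hs, ?_⟩
      grind
  filter_upwards [eventually_ge_atTop n₀] with n hn
  obtain ⟨s, hs, hvs⟩ := hexcursion n hn
  linarith [hosc hs (show N' ≤ n by omega)]

theorem eventually_lt_of_frequently_lt (h : IsProjRec lo hi f a w v) (hlh : lo ≤ hi)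
    (hf : Continuous f) (ha0 : ∀ n, 0 ≤ a n) (ha : Tendsto a atTop (𝓝 0))
    (hw : CauchySeq fun n => ∑ i ∈ Finset.range n, a i * w i)
    {b c : ℝ} (hbc : b < c) (hc : c ≤ hi) (hfc : 0 < f c)
    (hfreq : ∃ᶠ n in atTop, c < v n) : ∀ᶠ n in atTop, b < v n := by
  obtain ⟨ε, hε, hpos⟩ :=
    Metric.eventually_nhds_iff_ball.1 (hf.continuousAt.eventually_const_lt hfc)
  have hδ : 0 < min ε (c - b) := lt_min hε (sub_pos.2 hbc)
  refine (h.eventually_sub_lt_of_frequently_lt hlh hf ha0 ha hw hc hδ (fun u hu => ?_) hfreq).mono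
    fun n hn => by linarith [min_le_right ε (c - b)]
  refine (hpos u ?_).le
  rw [Real.ball_eq_Ioo]
  exact ⟨by linarith [hu.1, min_le_left ε (c - b)], by linarith [hu.2]⟩

theorem exists_tendsto (h : IsProjRec lo hi f a w v) (hlh : lo ≤ hi) (hf : Continuous f)
    (hf0 : Dense {u | f u ≠ 0}) (ha0 : ∀ n, 0 ≤ a n) (ha : Tendsto a atTop (𝓝 0))
    (hw : CauchySeq fun n => ∑ i ∈ Finset.range n, a i * w i) :
    ∃ l, Tendsto v atTop (𝓝 l) := by
  have hIcc := h.eventually_mem_Icc hlh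
  refine tendsto_of_no_upcrossings dense_univ ?_
    (isBoundedUnder_of_eventually_le (hIcc.mono fun n hn => hn.2))
    (isBoundedUnder_of_eventually_ge (hIcc.mono fun n hn => hn.1))
  rintro b - e - hbe ⟨hlt, hgt⟩
  obtain ⟨c, hfc, hbc, hce⟩ := hf0.exists_mem_open isOpen_Ioo (Set.nonempty_Ioo.2 hbe)
  rcases lt_or_gt_of_ne (show f c ≠ 0 from hfc) with hneg | hpos
  · obtain ⟨n, hn, hn'⟩ := (hlt.and_eventually hIcc).exists
    have hev := (h.neg hlh).eventually_lt_of_frequently_lt (neg_le_neg hlh) (by fun_prop) ha0 ha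
      (cauchySeq_sum_mul_neg hw) (neg_lt_neg hce) (neg_le_neg (by linarith [hn'.1]))
      (by rwa [neg_neg, neg_pos]) (hlt.mono fun n hn => neg_lt_neg (hn.trans hbc))
    exact hgt (hev.mono fun n hn => (neg_lt_neg_iff.1 hn).not_gt)
  · obtain ⟨n, hn, hn'⟩ := (hgt.and_eventually hIcc).exists
    have hev := h.eventually_lt_of_frequently_lt hlh hf ha0 ha hw hbc (by linarith [hn'.2]) hpos
      (hgt.mono fun n hn => hce.trans hn)
    exact hlt (hev.mono fun n hn => hn.not_gt)

theorem nonpos_of_tendsto (h : IsProjRec lo hi f a w v) (hf : Continuous f) (ha0 : ∀ n, 0 ≤ a n)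
    (hsum : ¬ Summable a) (hw : CauchySeq fun n => ∑ i ∈ Finset.range n, a i * w i)
    {l : ℝ} (hl : l ∈ Set.Ioo lo hi) (hv : Tendsto v atTop (𝓝 l)) : f l ≤ 0 := by
  by_contra! hfl
  obtain ⟨s, hs⟩ := cauchySeq_tendsto_of_complete hw
  obtain ⟨N, hN⟩ := eventually_atTop.1 <|
    (((hf.tendsto l).comp hv).eventually_const_lt (half_lt_self hfl)).and
      (hv.eventually (isOpen_Ioo.mem_nhds hl))
  set T : ℕ → ℝ := fun n => v (n + N) - ∑ i ∈ Finset.range (n + N), a i * w i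
  have hT (n : ℕ) : a (n + N) * f (v (n + N)) = T (n + 1) - T n := by
    simp only [T, Nat.add_right_comm n 1 N]
    rw [h.eq_of_mem_Ioo (hN (n + N + 1) (by omega)).2, Finset.sum_range_succ]
    ring
  have hfv (n : ℕ) : f l / 2 < f (v (n + N)) := (hN (n + N) (by omega)).1
  have hT_mono : Monotone T := monotone_nat_of_le_succ fun n => sub_nonneg.1 <|
    hT n ▸ mul_nonneg (ha0 _) (by linarith [hfv n])
  have hT_lim : Tendsto T atTop (𝓝 (l - s)) := (tendsto_add_atTop_iff_nat N).2 (hv.sub hs)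
  have hle (n : ℕ) : a (n + N) * (f l / 2) ≤ T (n + 1) - T n :=
    hT n ▸ mul_le_mul_of_nonneg_left (hfv n).le (ha0 _)
  refine hsum ((summable_nat_add_iff N).1 ?_)
  refine (summable_mul_right_iff (half_pos hfl).ne').1 ?_
  exact .of_nonneg_of_le (fun n => mul_nonneg (ha0 _) (half_pos hfl).le) hle
    (summable_sub_of_monotone_of_tendsto hT_mono hT_lim)

theorem eq_zero_of_tendsto (h : IsProjRec lo hi f a w v) (hf : Continuous f) (ha0 : ∀ n, 0 ≤ a n)
    (hsum : ¬ Summable a) (hw : CauchySeq fun n => ∑ i ∈ Finset.range n, a i * w i)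
    {l : ℝ} (hl : l ∈ Set.Ioo lo hi) (hv : Tendsto v atTop (𝓝 l)) : f l = 0 := by
  refine (h.nonpos_of_tendsto hf ha0 hsum hw hl hv).antisymm ?_
  have hneg := (h.neg (hl.1.trans hl.2).le).nonpos_of_tendsto (by fun_prop) ha0 hsum
    (cauchySeq_sum_mul_neg hw) ⟨neg_lt_neg hl.2, neg_lt_neg hl.1⟩ hv.neg
  simpa only [neg_neg, neg_nonpos] using hneg

-- Under a common noise two paths in a region where `f` is monotone can only drift apart.
theorem eq_of_tendsto_of_monotoneOn {w' v' : ℕ → ℝ} (h : IsProjRec lo hi f a w v)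
    (h' : IsProjRec lo hi f a w' v') (ha0 : ∀ n, 0 ≤ a n) {s : Set ℝ} (hs : s ⊆ Set.Ioo lo hi)
    (hf : MonotoneOn f s) {N : ℕ} (hw : ∀ n ≥ N, w n = w' n) (hv : ∀ n ≥ N, v n ∈ s)
    (hv' : ∀ n ≥ N, v' n ∈ s) {u : ℝ} (hu : Tendsto v atTop (𝓝 u))
    (hu' : Tendsto v' atTop (𝓝 u)) : v N = v' N := by
  wlog hle : v N ≤ v' N generalizing v v' w w'
  · exact (this h' h (fun n hn => (hw n hn).symm) hv' hv hu' hu (le_of_not_ge hle)).symm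
  have hgap : ∀ n ≥ N, v' N - v N ≤ v' n - v n := by
    intro n hn
    induction n, hn using Nat.le_induction with
    | base => exact le_rfl
    | succ n hn ih =>
      rw [h.eq_of_mem_Ioo (hs (hv _ (by omega))), h'.eq_of_mem_Ioo (hs (hv' _ (by omega))), hw n hn]
      have := mul_le_mul_of_nonneg_left (hf (hv n hn) (hv' n hn) (by linarith)) (ha0 n)
      linarith
  linarith [ge_of_tendsto (hu'.sub hu) (eventually_atTop.2 ⟨N, hgap⟩)]

end IsProjRec

section Measurability

variable {lo hi : ℝ} {f : ℝ → ℝ} {a : ℕ → ℝ}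

theorem projRec_congr {x₀ : ℝ} {w w' : ℕ → ℝ} {n : ℕ} (h : ∀ k < n, w k = w' k) :
    projRec lo hi f a x₀ w n = projRec lo hi f a x₀ w' n := by
  induction n with
  | zero => rfl
  | succ n ih => rw [projRec, projRec, ih fun k hk => h k (by omega), h n n.lt_succ_self]

theorem measurable_projRec (hf : Measurable f) (n : ℕ) :
    Measurable fun p : ℝ × (ℕ → ℝ) => projRec lo hi f a p.1 p.2 n := by
  induction n with
  | zero => exact measurable_fst
  | succ n ih =>
    refine (continuous_clamp lo hi).measurable.comp ?_
    fun_prop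

/-- The pairs (initial value, noise) for which the projected recursion stays in `s` after time `N`
and converges to `u`. -/
def captureSet (lo hi : ℝ) (f : ℝ → ℝ) (a : ℕ → ℝ) (s : Set ℝ) (u : ℝ) (N : ℕ) :
    Set (ℝ × (ℕ → ℝ)) :=
  {p | ∀ n > N, projRec lo hi f a p.1 p.2 n ∈ s} ∩
    {p | Tendsto (projRec lo hi f a p.1 p.2) atTop (𝓝 u)}

theorem measurableSet_captureSet (hf : Measurable f) {s : Set ℝ} (hs : MeasurableSet s) (u : ℝ)
    (N : ℕ) : MeasurableSet (captureSet lo hi f a s u N) := by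
  refine .inter ?_ (measurableSet_tendsto (𝓝 u) (measurable_projRec hf))
  simp only [Set.ofPred_forall]
  exact .iInter fun n => .iInter fun _ => measurable_projRec hf n hs

theorem subsingleton_update_mem_captureSet (ha : ∀ n, 0 < a n) {s : Set ℝ} (hs : s ⊆ Set.Ioo lo hi)
    (hf : MonotoneOn f s) (u x₀ : ℝ) (w : ℕ → ℝ) (N : ℕ) :
    {t | (x₀, Function.update w N t) ∈ captureSet lo hi f a s u N}.Subsingleton := by
  rintro t ⟨ht, htu⟩ t' ⟨ht', htu'⟩
  have h := isProjRec_projRec lo hi f a x₀ (Function.update w N t)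
  have h' := isProjRec_projRec lo hi f a x₀ (Function.update w N t')
  have hnext := h.eq_of_tendsto_of_monotoneOn h' (fun n => (ha n).le) hs hf (N := N + 1)
    (fun n hn => by simp only [Function.update_of_ne (show n ≠ N by omega)]) ht ht' htu htu'
  have hprev : projRec lo hi f a x₀ (Function.update w N t) N =
      projRec lo hi f a x₀ (Function.update w N t') N :=
    projRec_congr fun k hk => by simp only [Function.update_of_ne hk.ne]
  rw [h.eq_of_mem_Ioo (hs (ht _ N.lt_succ_self)), h'.eq_of_mem_Ioo (hs (ht' _ N.lt_succ_self)),
    hprev, Function.update_self, Function.update_self] at hnext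
  exact add_left_cancel (mul_left_cancel₀ (ha N).ne' (add_left_cancel hnext))

end Measurability

section Independence

variable {Ω : Type*} [MeasurableSpace Ω] {μ : Measure Ω}

theorem ae_prodMk_mem_of_indepFun {α β : Type*} [MeasurableSpace α] [MeasurableSpace β]
    [IsFiniteMeasure μ] {X : Ω → α} {Y : Ω → β} (hX : AEMeasurable X μ) (hY : AEMeasurable Y μ)
    (hXY : IndepFun X Y μ) {s : Set (α × β)} (hs : MeasurableSet s)
    (h : ∀ x, ∀ᵐ ω ∂μ, (x, Y ω) ∈ s) : ∀ᵐ ω ∂μ, (X ω, Y ω) ∈ s := by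
  refine ae_of_ae_map (p := (· ∈ s)) (hX.prodMk hY) ?_
  rw [(indepFun_iff_map_prod_eq_prod_map_map hX hY).1 hXY, Measure.ae_prod_mem_iff_ae_ae_mem hs]
  exact .of_forall fun x => (ae_map_iff hY (measurable_prodMk_left hs)).2 (h x)

theorem indepFun_update {ι β : Type*} [DecidableEq ι] [MeasurableSpace β] {w : ι → Ω → β}
    (hw : ∀ i, Measurable (w i)) (hind : iIndepFun w μ) (i : ι) (b : β) :
    IndepFun (fun ω => Function.update (fun j => w j ω) i b) (w i) μ := by
  have h : Indep (⨆ j ∈ ({i}ᶜ : Set ι), MeasurableSpace.comap (w j) inferInstance)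
      (⨆ j ∈ ({i} : Set ι), MeasurableSpace.comap (w j) inferInstance) μ :=
    indep_iSup_of_disjoint (fun j => (hw j).comap_le) hind disjoint_compl_left
  rw [iSup_singleton] at h
  rw [IndepFun_iff_Indep]
  refine indep_of_indep_of_le_left h (Measurable.comap_le ?_)
  refine @measurable_pi_lambda _ _ _ (_) _ _ fun j => ?_
  rcases eq_or_ne j i with rfl | hj
  · simp only [Function.update_self]
    exact measurable_const
  · simp only [Function.update_of_ne hj]
    exact measurable_iff_comap_le.2 (le_iSup₂_of_le j hj le_rfl)

variable [IsProbabilityMeasure μ] {lo hi : ℝ} {f : ℝ → ℝ} {a : ℕ → ℝ} {x₀ : Ω → ℝ}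
  {w : ℕ → Ω → ℝ}

theorem ae_notMem_captureSet (hf : Measurable f) (ha : ∀ n, 0 < a n) (hx₀ : AEMeasurable x₀ μ)
    (hw : ∀ n, Measurable (w n)) (hind : iIndepFun w μ)
    (hdiff : ∀ n, NullSingletonClass (μ.map (w n)))
    (hx₀w : IndepFun x₀ (fun ω n => w n ω) μ) {s : Set ℝ} (hs : MeasurableSet s)
    (hsub : s ⊆ Set.Ioo lo hi) (hmono : MonotoneOn f s) (u : ℝ) (N : ℕ) :
    ∀ᵐ ω ∂μ, (x₀ ω, fun n => w n ω) ∉ captureSet lo hi f a s u N := by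
  have hcapture : MeasurableSet (captureSet lo hi f a s u N)ᶜ :=
    (measurableSet_captureSet hf hs u N).compl
  have hwm : Measurable fun ω n => w n ω := measurable_pi_lambda _ hw
  refine ae_prodMk_mem_of_indepFun hx₀ hwm.aemeasurable hx₀w hcapture fun x => ?_
  have hupdate : Measurable fun q : (ℕ → ℝ) × ℝ => Function.update q.1 N q.2 := measurable_update'
  have hsection (y : ℕ → ℝ) :
      ∀ᵐ ω ∂μ, (x, Function.update y N (w N ω)) ∈ (captureSet lo hi f a s u N)ᶜ := by
    have := hdiff N
    exact ae_of_ae_map (hw N).aemeasurable <| measure_eq_zero_iff_ae_notMem.1 <|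
      (subsingleton_update_mem_captureSet ha hsub hmono u x y N).measure_zero (μ.map (w N))
  simpa using ae_prodMk_mem_of_indepFun (by fun_prop) (by fun_prop)
    (indepFun_update hw hind N 0) ((measurable_prodMk_left hcapture).preimage hupdate) hsection

theorem ae_not_tendsto_projRec (hf : ContDiff ℝ 1 f) (ha : ∀ n, 0 < a n) (hx₀ : AEMeasurable x₀ μ)
    (hw : ∀ n, Measurable (w n)) (hind : iIndepFun w μ)
    (hdiff : ∀ n, NullSingletonClass (μ.map (w n)))
    (hx₀w : IndepFun x₀ (fun ω n => w n ω) μ) {u : ℝ} (hu : u ∈ Set.Ioo lo hi)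
    (hderiv : 0 < deriv f u) :
    ∀ᵐ ω ∂μ, ¬ Tendsto (projRec lo hi f a (x₀ ω) fun n => w n ω) atTop (𝓝 u) := by
  obtain ⟨ε, hε, hmono⟩ := exists_Ioo_monotoneOn_of_deriv_pos hf hderiv
  have hopen : IsOpen (Set.Ioo (u - ε) (u + ε) ∩ Set.Ioo lo hi) := isOpen_Ioo.inter isOpen_Ioo
  filter_upwards [ae_all_iff.2 (ae_notMem_captureSet hf.continuous.measurable ha hx₀ hw hind hdiff
    hx₀w hopen.measurableSet Set.inter_subset_right (hmono.mono Set.inter_subset_left) u)]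
    with ω hω hlim
  obtain ⟨N, hN⟩ := eventually_atTop.1 <|
    hlim.eventually (hopen.mem_nhds ⟨⟨by linarith, by linarith⟩, hu⟩)
  exact hω N ⟨fun n hn => hN n (le_of_lt hn), hlim⟩

end Independence

section NoiseSeries

variable {Ω : Type*} [MeasurableSpace Ω] {μ : Measure Ω} [IsProbabilityMeasure μ]
  {X : ℕ → Ω → ℝ}

theorem martingale_sum_of_iIndepFun (hX : ∀ n, Measurable (X n)) (hint : ∀ n, Integrable (X n) μ)
    (hmean : ∀ n, μ[X n] = 0) (hind : iIndepFun X μ) :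
    Martingale (fun n => ∑ i ∈ Finset.range (n + 1), X i)
      (Filtration.natural X fun n => (hX n).stronglyMeasurable) μ := by
  set ℱ := Filtration.natural X fun n => (hX n).stronglyMeasurable
  have hX_adapted : StronglyAdapted ℱ X := Filtration.stronglyAdapted_natural _
  have hsum_adapted : StronglyAdapted ℱ fun n => ∑ i ∈ Finset.range (n + 1), X i := fun n =>
    Finset.stronglyMeasurable_sum _ fun i hi =>
      (hX_adapted i).mono (ℱ.mono (by grind))
  have hsum_int (n : ℕ) : Integrable (∑ i ∈ Finset.range (n + 1), X i) μ :=
    integrable_finsetSum' _ fun i _ => hint i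
  refine martingale_nat hsum_adapted hsum_int fun n => ?_
  have hpast := condExp_of_stronglyMeasurable (ℱ.le n) (hsum_adapted n) (hsum_int n)
  have hfuture := hind.condExp_natural_ae_eq_of_lt (fun n => (hX n).stronglyMeasurable)
    (Nat.lt_succ_self n)
  rw [Finset.sum_range_succ _ (n + 1)]
  filter_upwards [condExp_add (hsum_int n) (hint (n + 1)) (ℱ n), hfuture] with ω hω hω'
  rw [hω, Pi.add_apply, hpast, hω', hmean, add_zero]

theorem eLpNorm_one_le_one_add_variance {Y : Ω → ℝ} (hY : MemLp Y 2 μ) (hmean : μ[Y] = 0) :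
    eLpNorm Y 1 μ ≤ ENNReal.ofReal (1 + variance Y μ) := by
  have hint : Integrable Y μ := hY.integrable one_le_two
  have hsq : Integrable (fun ω => Y ω ^ 2) μ := hY.integrable_sq
  rw [eLpNorm_one_eq_lintegral_enorm, ← ofReal_integral_norm_eq_lintegral_enorm hint,
    variance_of_integral_eq_zero hint.aemeasurable hmean]
  refine ENNReal.ofReal_le_ofReal ?_
  calc ∫ ω, ‖Y ω‖ ∂μ ≤ ∫ ω, (1 + Y ω ^ 2) ∂μ :=
        integral_mono hint.norm ((integrable_const 1).add hsq) fun ω => by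
          rw [Real.norm_eq_abs]
          nlinarith [sq_abs (Y ω), sq_nonneg (|Y ω| - 1)]
    _ = 1 + ∫ ω, Y ω ^ 2 ∂μ := by
        rw [integral_add (integrable_const 1) hsq, integral_const, probReal_univ, one_smul]

theorem ae_cauchySeq_sum_of_summable_variance (hX : ∀ n, Measurable (X n))
    (hL2 : ∀ n, MemLp (X n) 2 μ) (hmean : ∀ n, μ[X n] = 0) (hind : iIndepFun X μ)
    (hvar : Summable fun n => variance (X n) μ) :
    ∀ᵐ ω ∂μ, CauchySeq fun n => ∑ i ∈ Finset.range n, X i ω := by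
  have hint (n : ℕ) : Integrable (X n) μ := (hL2 n).integrable one_le_two
  have hbdd (n : ℕ) : eLpNorm (∑ i ∈ Finset.range (n + 1), X i) 1 μ ≤
      (1 + ∑' i, variance (X i) μ).toNNReal := by
    refine (eLpNorm_one_le_one_add_variance (memLp_finsetSum' _ fun i _ => hL2 i) ?_).trans ?_
    · simp only [Finset.sum_apply, integral_finsetSum _ fun i _ => hint i, hmean,
        Finset.sum_const_zero]
    · rw [IndepFun.variance_sum (fun i _ => hL2 i) fun i _ j _ hij => hind.indepFun hij]
      exact ENNReal.ofReal_le_ofReal <| by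
        gcongr
        exact hvar.sum_le_tsum _ fun i _ => variance_nonneg _ _
  filter_upwards [(martingale_sum_of_iIndepFun hX hint hmean hind).submartingale
    |>.exists_ae_tendsto_of_bdd hbdd] with ω ⟨l, hl⟩
  simp only [Finset.sum_apply] at hl
  exact ((tendsto_add_atTop_iff_nat 1).1 hl).cauchySeq

end NoiseSeries

/-- The Robbins–Monro step size conditions: positive steps with divergent sum and convergent sum
of squares. -/
structure IsRobbinsMonro (a : ℕ → ℝ) : Prop where
  pos : ∀ n, 0 < a n
  not_summable : ¬ Summable a
  summable_sq : Summable fun n => a n ^ 2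

theorem IsRobbinsMonro.tendsto_zero {a : ℕ → ℝ} (ha : IsRobbinsMonro a) :
    Tendsto a atTop (𝓝 0) := by
  have hsqrt : Tendsto (fun n => √(a n ^ 2)) atTop (𝓝 0) := by
    simpa [Function.comp_def] using
      (Real.continuous_sqrt.tendsto 0).comp ha.summable_sq.tendsto_atTop_zero
  exact hsqrt.congr fun n => Real.sqrt_sq (ha.pos n).le

/-- Noise for stochastic approximation: independent centred random variables of bounded variance
whose laws have no atoms (so that the noise drives the recursion off unstable equilibria). -/
structure IsDiffuseNoise {Ω : Type*} [MeasurableSpace Ω] (w : ℕ → Ω → ℝ) (μ : Measure Ω) :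
    Prop where
  measurable : ∀ n, Measurable (w n)
  memLp_two : ∀ n, MemLp (w n) 2 μ
  integral_eq_zero : ∀ n, μ[w n] = 0
  bddAbove_variance : BddAbove (Set.range fun n => variance (w n) μ)
  iIndepFun : iIndepFun w μ
  nullSingletonClass : ∀ n, NullSingletonClass (μ.map (w n))

namespace IsDiffuseNoise

variable {Ω : Type*} [MeasurableSpace Ω] {μ : Measure Ω} {w : ℕ → Ω → ℝ}

theorem of_map_eq_gaussianReal (hw : ∀ n, Measurable (w n)) (hind : ProbabilityTheory.iIndepFun w μ)
    {σ : ℝ≥0} (hσ : σ ≠ 0) (hlaw : ∀ n, μ.map (w n) = gaussianReal 0 σ) :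
    IsDiffuseNoise w μ := by
  have hasLaw (n : ℕ) : HasLaw (w n) (gaussianReal 0 σ) μ := ⟨(hw n).aemeasurable, hlaw n⟩
  refine ⟨hw, fun n => ?_, fun n => ?_, ⟨σ, ?_⟩, hind, fun n => ?_⟩
  · have := memLp_id_gaussianReal' (μ := 0) (v := σ) 2 ENNReal.ofNat_ne_top
    exact (hlaw n ▸ this).comp_of_map (hw n).aemeasurable
  · rw [(hasLaw n).integral_eq, integral_id_gaussianReal]
  · rintro _ ⟨n, rfl⟩
    simp only [(hasLaw n).variance_eq, variance_id_gaussianReal, le_refl]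
  · exact hlaw n ▸ nullSingletonClass_gaussianReal hσ

theorem const_mul (hw : IsDiffuseNoise w μ) {c : ℝ} (hc : c ≠ 0) :
    IsDiffuseNoise (fun n ω => c * w n ω) μ where
  measurable n := (hw.measurable n).const_mul c
  memLp_two n := (hw.memLp_two n).const_mul c
  integral_eq_zero n := by rw [integral_const_mul, hw.integral_eq_zero, mul_zero]
  bddAbove_variance := by
    obtain ⟨C, hC⟩ := hw.bddAbove_variance
    refine ⟨c ^ 2 * C, ?_⟩
    rintro _ ⟨n, rfl⟩
    simp only [variance_const_mul]
    exact mul_le_mul_of_nonneg_left (hC ⟨n, rfl⟩) (sq_nonneg c)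
  iIndepFun := hw.iIndepFun.comp (fun _ t => c * t) fun _ => measurable_const_mul c
  nullSingletonClass n := by
    have := hw.nullSingletonClass n
    refine ⟨fun t => ?_⟩
    rw [← Function.comp_def (c * ·), ← Measure.map_map (by fun_prop) (hw.measurable n),
      Measure.map_apply (by fun_prop) (measurableSet_singleton t)]
    exact (Set.subsingleton_singleton.preimage (mul_right_injective₀ hc)).measure_zero _

theorem ae_cauchySeq_sum_mul [IsProbabilityMeasure μ] (hw : IsDiffuseNoise w μ) {a : ℕ → ℝ}
    (ha : Summable fun n => a n ^ 2) :
    ∀ᵐ ω ∂μ, CauchySeq fun n => ∑ i ∈ Finset.range n, a i * w i ω := by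
  obtain ⟨C, hC⟩ := hw.bddAbove_variance
  refine ae_cauchySeq_sum_of_summable_variance (fun n => (hw.measurable n).const_mul (a n))
    (fun n => (hw.memLp_two n).const_mul (a n))
    (fun n => by rw [integral_const_mul, hw.integral_eq_zero, mul_zero])
    (hw.iIndepFun.comp (fun n t => a n * t) fun n => measurable_const_mul (a n)) ?_
  simp only [variance_const_mul]
  exact .of_nonneg_of_le (fun n => mul_nonneg (sq_nonneg _) (variance_nonneg _ _))
    (fun n => mul_le_mul_of_nonneg_left (hC ⟨n, rfl⟩) (sq_nonneg _)) (ha.mul_right C)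

end IsDiffuseNoise

theorem ae_exists_tendsto_projRec {Ω : Type*} [MeasurableSpace Ω] {μ : Measure Ω}
    [IsProbabilityMeasure μ] {lo hi : ℝ} (hlh : lo ≤ hi) {f : ℝ → ℝ} (hf : ContDiff ℝ 1 f)
    (hzeros : {u | f u = 0}.Countable) {a : ℕ → ℝ} (ha : IsRobbinsMonro a) {x₀ : Ω → ℝ}
    (hx₀ : AEMeasurable x₀ μ) {w : ℕ → Ω → ℝ} (hw : IsDiffuseNoise w μ)
    (hx₀w : IndepFun x₀ (fun ω n => w n ω) μ) :
    ∀ᵐ ω ∂μ, ∃ l, Tendsto (projRec lo hi f a (x₀ ω) fun n => w n ω) atTop (𝓝 l) ∧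
      (l = lo ∨ l = hi ∨ l ∈ Set.Ioo lo hi ∧ f l = 0 ∧ deriv f l ≤ 0) := by
  have hunstable : ∀ᵐ ω ∂μ, ∀ u ∈ {u | f u = 0}, u ∈ Set.Ioo lo hi → 0 < deriv f u →
      ¬ Tendsto (projRec lo hi f a (x₀ ω) fun n => w n ω) atTop (𝓝 u) := by
    simp only [ae_ball_iff hzeros, eventually_imp_distrib_left]
    exact fun u _ hu hderiv => ae_not_tendsto_projRec hf ha.pos hx₀ hw.measurable hw.iIndepFun
      hw.nullSingletonClass hx₀w hu hderiv
  filter_upwards [hw.ae_cauchySeq_sum_mul ha.summable_sq, hunstable] with ω hnoise hω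
  have hrec := isProjRec_projRec lo hi f a (x₀ ω) fun n => w n ω
  have ha0 (n : ℕ) : 0 ≤ a n := (ha.pos n).le
  obtain ⟨l, hl⟩ := hrec.exists_tendsto hlh hf.continuous (hzeros.dense_compl ℝ) ha0
    ha.tendsto_zero hnoise
  refine ⟨l, hl, ?_⟩
  have hl_mem : l ∈ Set.Icc lo hi := isClosed_Icc.mem_of_tendsto hl (hrec.eventually_mem_Icc hlh)
  rcases hl_mem.1.eq_or_lt with hlo | hlo
  · exact .inl hlo.symm
  rcases hl_mem.2.eq_or_lt with hhi | hhi
  · exact .inr (.inl hhi)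
  have hzero : f l = 0 :=
    hrec.eq_zero_of_tendsto hf.continuous ha0 ha.not_summable hnoise ⟨hlo, hhi⟩ hl
  exact .inr (.inr ⟨⟨hlo, hhi⟩, hzero, not_lt.1 fun h => hω l hzero ⟨hlo, hhi⟩ h hl⟩)

end StochasticApproximation

namespace BeamTracking

open StochasticApproximation

section SineSum

/-- The sine sum `∑ sin (2 m t)`, to which the mean field reduces after rescaling its argument. -/
noncomputable def sinSum (M : ℕ) (t : ℝ) : ℝ := ∑ m ∈ Finset.range M, Real.sin (2 * m * t)

theorem contDiff_sinSum (M : ℕ) : ContDiff ℝ 1 (sinSum M) := by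
  unfold sinSum
  fun_prop

theorem sinSum_mul_sin (M : ℕ) (t : ℝ) :
    sinSum M t * Real.sin t = Real.sin ((M - 1) * t) * Real.sin (M * t) := by
  unfold sinSum
  induction M with
  | zero => simp
  | succ n ih =>
    rw [Finset.sum_range_succ, add_mul, ih, Nat.cast_succ, add_sub_cancel_right, sub_one_mul,
      add_one_mul, mul_assoc 2, Real.sin_sub, Real.sin_add, Real.sin_two_mul]
    ring

theorem hasDerivAt_sin_const_mul (c t : ℝ) :
    HasDerivAt (fun s => Real.sin (c * s)) (c * Real.cos (c * t)) t := by
  simpa [mul_comm] using ((hasDerivAt_id t).const_mul c).sin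

theorem deriv_sinSum (M : ℕ) (t : ℝ) :
    deriv (sinSum M) t = ∑ m ∈ Finset.range M, 2 * m * Real.cos (2 * m * t) :=
  (HasDerivAt.fun_sum (u := Finset.range M) fun m _ => hasDerivAt_sin_const_mul (2 * m) t).deriv

theorem deriv_sinSum_mul_sin_add (M : ℕ) (t : ℝ) :
    deriv (sinSum M) t * Real.sin t + sinSum M t * Real.cos t =
      (M - 1) * Real.cos ((M - 1) * t) * Real.sin (M * t) +
        Real.sin ((M - 1) * t) * (M * Real.cos (M * t)) := by
  have hleft := ((contDiff_sinSum M).differentiable one_ne_zero t).hasDerivAt.mul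
    (Real.hasDerivAt_sin t)
  have hright := (hasDerivAt_sin_const_mul (M - 1) t).mul (hasDerivAt_sin_const_mul M t)
  exact hleft.unique (hright.congr_of_eventuallyEq (.of_forall (sinSum_mul_sin M)))

variable {M : ℕ} {t : ℝ}

theorem sinSum_eq_zero_of_sin_eq_zero (ht : Real.sin t = 0) : sinSum M t = 0 := by
  obtain ⟨k, rfl⟩ := Real.sin_eq_zero_iff.1 ht
  exact Finset.sum_eq_zero fun m _ => Real.sin_eq_zero_iff.2 ⟨2 * m * k, by push_cast; ring⟩

theorem deriv_sinSum_pos_of_sin_eq_zero (hM : 2 ≤ M) (ht : Real.sin t = 0) :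
    0 < deriv (sinSum M) t := by
  obtain ⟨k, rfl⟩ := Real.sin_eq_zero_iff.1 ht
  have hcos (m : ℕ) : Real.cos (2 * m * (k * Real.pi)) = 1 :=
    (Real.cos_eq_one_iff _).2 ⟨m * k, by push_cast; ring⟩
  simp only [deriv_sinSum, hcos, mul_one]
  exact Finset.sum_pos' (fun m _ => by positivity) ⟨1, Finset.mem_range.2 (by omega), by norm_num⟩

theorem deriv_sinSum_of_sin_sub_one_mul_eq_zero (ht : Real.sin t ≠ 0)
    (h : Real.sin ((M - 1) * t) = 0) : deriv (sinSum M) t = M - 1 := by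
  have hzero : sinSum M t = 0 := by simpa [h, ht] using sinSum_mul_sin M t
  have hsin : Real.sin (M * t) = Real.cos ((M - 1) * t) * Real.sin t := by
    rw [← sub_add_cancel ((M : ℝ) * t) t, Real.sin_add, ← sub_one_mul, h]
    ring
  have hcos : Real.cos ((M - 1) * t) ^ 2 = 1 := by rw [Real.cos_sq', h]; ring
  have hderiv := deriv_sinSum_mul_sin_add M t
  rw [hzero, h, hsin] at hderiv
  refine mul_right_cancel₀ ht ?_
  linear_combination hderiv + ((M : ℝ) - 1) * Real.sin t * hcos

theorem deriv_sinSum_of_sin_mul_eq_zero (ht : Real.sin t ≠ 0) (h : Real.sin (M * t) = 0) :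
    deriv (sinSum M) t = -M := by
  have hzero : sinSum M t = 0 := by simpa [h, ht] using sinSum_mul_sin M t
  have hsin : Real.sin ((M - 1) * t) = -(Real.cos (M * t) * Real.sin t) := by
    rw [sub_one_mul, Real.sin_sub, h]
    ring
  have hcos : Real.cos (M * t) ^ 2 = 1 := by rw [Real.cos_sq', h]; ring
  have hderiv := deriv_sinSum_mul_sin_add M t
  rw [hzero, h, hsin] at hderiv
  refine mul_right_cancel₀ ht ?_
  linear_combination hderiv - (M : ℝ) * Real.sin t * hcos

theorem sin_eq_zero_or_of_sinSum_eq_zero (h : sinSum M t = 0) :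
    Real.sin ((M - 1) * t) = 0 ∨ Real.sin (M * t) = 0 :=
  mul_eq_zero.1 (by rw [← sinSum_mul_sin, h, zero_mul])

theorem sinSum_eq_zero_and_deriv_pos_iff (hM : 2 ≤ M) :
    sinSum M t = 0 ∧ 0 < deriv (sinSum M) t ↔ Real.sin ((M - 1) * t) = 0 := by
  have hM' : (2 : ℝ) ≤ M := by exact_mod_cast hM
  by_cases ht : Real.sin t = 0
  · obtain ⟨k, rfl⟩ := Real.sin_eq_zero_iff.1 ht
    refine iff_of_true ⟨sinSum_eq_zero_of_sin_eq_zero ht, deriv_sinSum_pos_of_sin_eq_zero hM ht⟩ ?_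
    exact Real.sin_eq_zero_iff.2 ⟨(M - 1) * k, by push_cast; ring⟩
  refine ⟨fun ⟨hzero, hpos⟩ => (sin_eq_zero_or_of_sinSum_eq_zero hzero).resolve_right fun h => ?_,
    fun h => ⟨by simpa [h, ht] using sinSum_mul_sin M t, ?_⟩⟩
  · linarith [hpos, deriv_sinSum_of_sin_mul_eq_zero ht h]
  · linarith [deriv_sinSum_of_sin_sub_one_mul_eq_zero ht h]

theorem deriv_sinSum_ne_zero (hM : 2 ≤ M) (h : sinSum M t = 0) : deriv (sinSum M) t ≠ 0 := by
  have hM' : (2 : ℝ) ≤ M := by exact_mod_cast hM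
  by_cases ht : Real.sin t = 0
  · exact (deriv_sinSum_pos_of_sin_eq_zero hM ht).ne'
  rcases sin_eq_zero_or_of_sinSum_eq_zero h with h | h
  · linarith [deriv_sinSum_of_sin_sub_one_mul_eq_zero ht h]
  · linarith [deriv_sinSum_of_sin_mul_eq_zero ht h]

theorem countable_sin_const_mul_eq_zero {c : ℝ} (hc : c ≠ 0) :
    {t | Real.sin (c * t) = 0}.Countable := by
  refine (Set.countable_range fun k : ℤ => k * Real.pi / c).mono fun t ht => ?_
  obtain ⟨k, hk⟩ := Real.sin_eq_zero_iff.1 ht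
  exact ⟨k, by simp only [hk, mul_div_cancel_left₀ _ hc]⟩

theorem countable_sinSum_eq_zero (hM : 2 ≤ M) : {t | sinSum M t = 0}.Countable := by
  have hM' : (2 : ℝ) ≤ M := by exact_mod_cast hM
  exact ((countable_sin_const_mul_eq_zero (by linarith)).union
    (countable_sin_const_mul_eq_zero (by linarith))).mono
    fun _ => sin_eq_zero_or_of_sinSum_eq_zero

end SineSum

section MeanField

theorem meanField_eq_sinSum (M : ℕ) (d lam v x : ℝ) :
    meanField M d lam v x = -(1 / √(M : ℝ)) * sinSum M (Real.pi * d / lam * (v - x)) := by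
  rw [meanField_eq_sum, sinSum, Finset.sum_range]
  congr! 3
  ring

theorem contDiff_meanField (M : ℕ) (d lam x : ℝ) :
    ContDiff ℝ 1 fun u => meanField M d lam u x := by
  simp only [meanField_eq_sinSum]
  exact contDiff_const.mul ((contDiff_sinSum M).comp (by fun_prop))

theorem deriv_meanField (M : ℕ) (d lam v x : ℝ) :
    deriv (fun u => meanField M d lam u x) v = -(1 / √(M : ℝ)) * (Real.pi * d / lam) *
      deriv (sinSum M) (Real.pi * d / lam * (v - x)) := by
  have harg : HasDerivAt (fun u : ℝ => Real.pi * d / lam * (u - x)) (Real.pi * d / lam) v := by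
    simpa using ((hasDerivAt_id v).sub_const x).const_mul (Real.pi * d / lam)
  have hsum := ((contDiff_sinSum M).differentiable one_ne_zero _).hasDerivAt.comp v harg
  simp only [meanField_eq_sinSum]
  refine (hsum.const_mul (-(1 / √(M : ℝ)))).deriv.trans ?_
  ring

theorem sin_mul_eq_zero_iff_exists_int {c d lam : ℝ} (hc : c ≠ 0) (hd : d ≠ 0) (hlam : lam ≠ 0)
    (v x : ℝ) :
    Real.sin (c * (Real.pi * d / lam * (v - x))) = 0 ↔ ∃ k : ℤ, v = x + k * lam / (c * d) := by
  rw [Real.sin_eq_zero_iff]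
  refine exists_congr fun k => ?_
  rw [← sub_eq_iff_eq_add', eq_div_iff (mul_ne_zero hc hd)]
  field_simp
  constructor <;> intro h <;> linarith

variable {M : ℕ} {d lam : ℝ} (hM : 2 ≤ M) (hd : 0 < d) (hlam : 0 < lam) (v x : ℝ)

include hM in
theorem meanField_eq_zero_iff :
    meanField M d lam v x = 0 ↔ sinSum M (Real.pi * d / lam * (v - x)) = 0 := by
  have hM' : 0 < √(M : ℝ) := Real.sqrt_pos.2 (by positivity)
  rw [meanField_eq_sinSum, mul_eq_zero, or_iff_right (by simpa using hM'.ne')]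

include hM hd hlam

theorem deriv_meanField_neg_iff :
    deriv (fun u => meanField M d lam u x) v < 0 ↔
      0 < deriv (sinSum M) (Real.pi * d / lam * (v - x)) := by
  have hscale : 0 < 1 / √(M : ℝ) * (Real.pi * d / lam) := by positivity
  rw [deriv_meanField, neg_mul, neg_mul, neg_lt_zero, mul_pos_iff_of_pos_left hscale]

theorem deriv_meanField_ne_zero (h : meanField M d lam v x = 0) :
    deriv (fun u => meanField M d lam u x) v ≠ 0 := by
  have hscale : 0 < 1 / √(M : ℝ) * (Real.pi * d / lam) := by positivity
  rw [deriv_meanField, neg_mul]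
  exact mul_ne_zero (neg_ne_zero.2 hscale.ne')
    (deriv_sinSum_ne_zero hM ((meanField_eq_zero_iff hM v x).1 h))

theorem countable_meanField_eq_zero : {v | meanField M d lam v x = 0}.Countable := by
  have hinj : Function.Injective fun v => Real.pi * d / lam * (v - x) :=
    (mul_right_injective₀ (by positivity)).comp sub_left_injective
  simp only [meanField_eq_zero_iff hM]
  exact (countable_sinSum_eq_zero hM).preimage hinj

theorem stablePoints_eq :
    stablePoints M d lam x =
      {v | v ∈ Set.Ioc (-1 : ℝ) 1 ∧ ∃ k : ℤ, v = x + k * lam / (((M : ℝ) - 1) * d)} := by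
  have hM' : (2 : ℝ) ≤ M := by exact_mod_cast hM
  ext v
  refine and_congr_right fun _ => ?_
  rw [meanField_eq_zero_iff hM, deriv_meanField_neg_iff hM hd hlam,
    sinSum_eq_zero_and_deriv_pos_iff hM,
    sin_mul_eq_zero_iff_exists_int (by linarith) hd.ne' hlam.ne']

end MeanField

section Tracker

theorem proj_eq_clamp : proj = clamp (-1) 1 := by
  funext v
  rw [proj, clamp, max_comm, min_comm]

theorem im_observation_beamformer (M : ℕ) (d lam ρ x v : ℝ) (z : ℂ) :
    (observation M d lam ρ x (beamformer M d lam v) z).im =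
      -meanField M d lam v x + z.im / √ρ := by
  unfold observation beamformer meanField
  rw [star_smul, smul_dotProduct, Complex.add_im, Complex.div_ofReal_im, Complex.star_def,
    Complex.conj_ofReal, smul_eq_mul, Complex.im_ofReal_mul]
  ring

theorem estimate_eq_projRec (M : ℕ) (d lam ρ x : ℝ) (a : ℕ → ℝ) (x₀ : ℝ) (z : ℕ → ℂ) :
    estimate M d lam ρ x a x₀ z =
      projRec (-1) 1 (fun u => meanField M d lam u x) (fun n => a (n + 1)) x₀
        fun n => -(1 / √ρ) * (z (n + 1)).im := by
  funext n
  induction n with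
  | zero => rfl
  | succ n ih =>
    rw [estimate, projRec, ih, im_observation_beamformer, proj_eq_clamp]
    congr 1
    ring

theorem map_im_complexGaussian (s : ℝ≥0) :
    (complexGaussian 0 s).map Complex.im = gaussianReal 0 (s / 2) := by
  have him : (Complex.im ∘ fun p : ℝ × ℝ => (0 : ℂ) + ((p.1 : ℂ) + (p.2 : ℂ) * Complex.I)) =
      Prod.snd := by
    funext p
    simp
  rw [complexGaussian, Measure.map_map Complex.measurable_im (by fun_prop), him,
    Measure.map_snd_prod, measure_univ, one_smul]

theorem isDiffuseNoise_im {Ω : Type*} [MeasurableSpace Ω] {μ : Measure Ω} {z : ℕ → Ω → ℂ}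
    {s : ℝ≥0} (hs : s ≠ 0) (hz : ∀ n, Measurable (z n))
    (hlaw : ∀ n, μ.map (z n) = complexGaussian 0 s) (hind : iIndepFun z μ) :
    IsDiffuseNoise (fun n ω => (z n ω).im) μ :=
  .of_map_eq_gaussianReal (fun n => Complex.measurable_im.comp (hz n))
    (hind.comp (fun _ => Complex.im) fun _ => Complex.measurable_im)
    (div_ne_zero hs two_ne_zero) fun n => by
      rw [← map_im_complexGaussian, ← hlaw n, Measure.map_map Complex.measurable_im (hz n)]
      rfl

theorem isRobbinsMonro_stepSize {α N₀ : ℝ} (hα : 0 < α) (hN₀ : 0 ≤ N₀) :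
    IsRobbinsMonro fun n => stepSize α N₀ (n + 1) := by
  have hpos (n : ℕ) : 0 < (n : ℝ) + (1 + N₀) := by positivity
  have hstep (n : ℕ) : stepSize α N₀ (n + 1) = α * (1 / ((n : ℝ) + (1 + N₀))) := by
    rw [stepSize, mul_one_div, Nat.cast_succ, add_assoc]
  have hpow (s : ℝ) : (Summable fun n : ℕ => (1 / ((n : ℝ) + (1 + N₀))) ^ s) ↔ 1 < s := by
    rw [← Real.summable_one_div_nat_add_rpow (1 + N₀)]
    refine summable_congr fun n => ?_
    rw [abs_of_pos (hpos n), Real.div_rpow zero_le_one (hpos n).le, Real.one_rpow]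
  refine ⟨fun n => ?_, ?_, ?_⟩
  · rw [hstep]
    exact mul_pos hα (one_div_pos.2 (hpos n))
  · simp only [hstep, summable_mul_left_iff hα.ne']
    simpa using (hpow 1).not
  · simp only [hstep, mul_pow]
    exact .mul_left _ (by exact_mod_cast (hpow 2).2 one_lt_two)

end Tracker

end BeamTracking

open BeamTracking StochasticApproximation in
theorem theorem1_general
    {Ω : Type*} [MeasurableSpace Ω] (μ : Measure Ω) [IsProbabilityMeasure μ]
    (M : ℕ) (hM : 2 ≤ M)
    (d lam ρ : ℝ) (hd : 0 < d) (hlam : 0 < lam) (hρ : 0 < ρ) (x : ℝ)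
    (x₀ : Ω → ℝ) (hx₀ : AEMeasurable x₀ μ)
    (z : ℕ → Ω → ℂ) (hz : IsDiffuseNoise (fun n ω => (z (n + 1) ω).im) μ)
    (hx₀z : IndepFun x₀ (fun ω (n : ℕ) => (z (n + 1) ω).im) μ)
    (a : ℕ → ℝ) (ha : IsRobbinsMonro fun n => a (n + 1)) :
    stablePoints M d lam x =
        {v | v ∈ Set.Ioc (-1 : ℝ) 1 ∧ ∃ k : ℤ, v = x + k * lam / (((M : ℝ) - 1) * d)} ∧
      ∀ᵐ ω ∂μ, ∃ v ∈ stablePoints M d lam x ∪ {-1} ∪ {1},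
        Tendsto (estimate M d lam ρ x a (x₀ ω) fun n => z n ω) atTop (𝓝 v) := by
  refine ⟨stablePoints_eq hM hd hlam x, ?_⟩
  have hnoise := hz.const_mul (neg_ne_zero.2 (one_div_pos.2 (Real.sqrt_pos.2 hρ)).ne')
  have hindep : IndepFun x₀ (fun ω (n : ℕ) => -(1 / √ρ) * (z (n + 1) ω).im) μ :=
    hx₀z.comp (ψ := fun (w : ℕ → ℝ) (n : ℕ) => -(1 / √ρ) * w n) measurable_id (by fun_prop)
  filter_upwards [ae_exists_tendsto_projRec (neg_le_self zero_le_one)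
    (contDiff_meanField M d lam x) (countable_meanField_eq_zero hM hd hlam x) ha hx₀ hnoise hindep]
    with ω ⟨l, hl, hlim⟩
  refine ⟨l, ?_, by rwa [estimate_eq_projRec]⟩
  rcases hlim with rfl | rfl | ⟨hmem, hzero, hderiv⟩
  · exact .inl (.inr rfl)
  · exact .inr rfl
  · exact .inl (.inl ⟨Set.Ioo_subset_Ioc_self hmem, hzero,
      hderiv.lt_of_ne (deriv_meanField_ne_zero hM hd hlam l x hzero)⟩)

theorem theorem1
    {Ω : Type*} [MeasurableSpace Ω] (μ : Measure Ω) [IsProbabilityMeasure μ]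
    (M : ℕ) (hM : 2 ≤ M)
    (d lam ρ : ℝ) (hd : 0 < d) (hlam : 0 < lam) (hρ : 0 < ρ)
    (x : ℝ) (hx : x ∈ Set.Icc (-1 : ℝ) 1)
    (x₀ : Ω → ℝ) (hx₀ : Measurable x₀)
    (z : ℕ → Ω → ℂ) (hz : ∀ n, 1 ≤ n → Measurable (z n))
    (hz_law : ∀ n, 1 ≤ n → μ.map (z n) = BeamTracking.complexGaussian 0 1)
    (hz_indep : iIndepFun (fun n : ℕ => z (n + 1)) μ)
    (hx₀z : IndepFun x₀ (fun ω (n : ℕ) => z (n + 1) ω) μ)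
    (α N₀ : ℝ) (hα : 0 < α) (hN₀ : 0 ≤ N₀) :
    BeamTracking.stablePoints M d lam x =
        {v | v ∈ Set.Ioc (-1 : ℝ) 1 ∧ ∃ k : ℤ, v = x + k * lam / (((M : ℝ) - 1) * d)} ∧
      ∀ᵐ ω ∂μ, ∃ v ∈ BeamTracking.stablePoints M d lam x ∪ {-1} ∪ {1},
        Tendsto (fun n : ℕ => BeamTracking.estimate M d lam ρ x
          (BeamTracking.stepSize α N₀) (x₀ ω) (fun n => z n ω) n) atTop (𝓝 v) :=
  theorem1_general μ M hM d lam ρ hd hlam hρ x x₀ hx₀.aemeasurable z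
    (BeamTracking.isDiffuseNoise_im one_ne_zero (fun n => hz (n + 1) n.succ_pos)
      (fun n => hz_law (n + 1) n.succ_pos) hz_indep)
    (hx₀z.comp (ψ := fun (c : ℕ → ℂ) (n : ℕ) => (c n).im) measurable_id (by fun_prop))
    _ (BeamTracking.isRobbinsMonro_stepSize hα hN₀)
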